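/- Let $G=(V,E)$ be a strongly connected, unweighted digraph with $n\ge 2$ nodes, let $A\in\{0,1\}^{n\times n}$ be its adjacency matrix ($a_{ij}=1$ if and only if $(i,j)\in E$), and let $\lambda_1$ be the spectral radius of $A$. The out-degree $d_i^{\rm out}$ (in-degree $d_i^{\rm in}$) of node $i$ is the number of edges starting (ending) at $i$. A dominant right (left) eigenvector of $A$ is an entrywise positive vector ${\bf x}$ with $A{\bf x}=\lambda_1{\bf x}$ (respectively ${\bf y}$ with ${\bf y}^TA=\lambda_1{\bf y}^T$). Then $\lambda_1>0$, dominant right and left eigenvectors exist, and $I-\alpha A$, $I-\alpha A^T$ are invertible for $0<\alpha<1/\lambda_1$. For an entrywise positive vector ${\bf v}$ let $$K^b(\alpha)=(I-\alpha A)^{-1}{\bf v},\quad K^r(\alpha)=(I-\alpha A^T)^{-1}{\bf v}\qquad(0<\alpha<1/\lambda_1),$$ $$EC^b(\beta)={\rm e}^{\beta A}{\bf v},\quad EC^r(\beta)={\rm e}^{\beta A^T}{\bf v}\qquad(\beta>0)$$ be the broadcast and receive Katz centralities and the broadcast and receive total communicabilities. We say that the rankings given by score vectors ${\bf s}(t)$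 converge to the ranking given by ${\bf w}$ in some limit of $t$ if, for all $t$ close enough to the limit, $w_i<w_j$ implies $s_i(t)<s_j(t)$ for all nodes $i,j$, and if moreover there are scalars $a(t)>0$ and $b(t)$, the same for all nodes, such that $a(t)\,s_i(t)+b(t)\to w_i$ for every $i$. (a) Let ${\bf v}={\bf 1}$ be the vector of all ones. As $\alpha\to0+$, the rankings given by $K^b(\alpha)$ and $K^r(\alpha)$ converge to those given by the out-degrees and the in-degrees, respectively. As $\beta\to0+$, the rankings given by $EC^b(\beta)$ and $EC^r(\beta)$ converge to those given by the out-degrees and the in-degrees, respectively. (b) Let ${\bf v}$ be an arbitrary entrywise positive vector. As $\alpha\to\frac1{\lambda_1}-$, the rankings given by $K^b(\alpha)$ and $K^r(\alpha)$ converge to those given by any dominant right eigenvector and any dominant left eigenvector of $A$, respectively. As $\beta\to\infty$, the rankings given by $EC^b(\beta)$ and $EC^r(\beta)$ converge to those given by any dominant right eigenvector and any dominant left eigenvector of $A$, respectively. -/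

import Mathlib

open Filter Topology Matrix

noncomputable section

namespace RankingLimits

variable {V : Type*}

/-- A digraph is strongly connected if every node can be reached from every node by a directed
walk (equivalently, by a directed path). -/
def StronglyConnected (G : Digraph V) : Prop :=
  ∀ i j : V, Relation.ReflTransGen G.Adj i j

open Classical in
/-- The adjacency matrix: `a i j = 1` if `(i, j)` is an edge, and `0` otherwise. -/
def adjacency (G : Digraph V) : Matrix V V ℝ :=
  Matrix.of fun i j => if G.Adj i j then 1 else 0

/-- The number of edges starting at `i`. -/
def outDegree (G : Digraph V) (i : V) : ℕ := {k : V | G.Adj i k}.ncard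

/-- The number of edges ending at `i`. -/
def inDegree (G : Digraph V) (i : V) : ℕ := {k : V | G.Adj k i}.ncard

variable [Fintype V] [DecidableEq V]

/-- The spectral radius of a real matrix: the largest modulus of a complex eigenvalue. For an
irreducible nonnegative matrix this is the dominant eigenvalue `lam₁`. -/
def dominantEigenvalue (A : Matrix V V ℝ) : ℝ :=
  (spectralRadius ℂ (A.map (fun a : ℝ => (a : ℂ)))).toReal

/-- `x` is a dominant right eigenvector: entrywise positive with `A x = lam₁ x`. -/
def IsDominantRightEigenvector (A : Matrix V V ℝ) (x : V → ℝ) : Prop :=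
  (∀ i, 0 < x i) ∧ A *ᵥ x = dominantEigenvalue A • x

/-- `y` is a dominant left eigenvector: entrywise positive with `yᵀ A = lam₁ yᵀ`. -/
def IsDominantLeftEigenvector (A : Matrix V V ℝ) (y : V → ℝ) : Prop :=
  (∀ i, 0 < y i) ∧ y ᵥ* A = dominantEigenvalue A • y

/-- Broadcast Katz centrality `(I - α A)⁻¹ v`. -/
def katzBroadcast (A : Matrix V V ℝ) (v : V → ℝ) (α : ℝ) : V → ℝ :=
  (1 - α • A)⁻¹ *ᵥ v

/-- Receive Katz centrality `(I - α Aᵀ)⁻¹ v`. -/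
def katzReceive (A : Matrix V V ℝ) (v : V → ℝ) (α : ℝ) : V → ℝ :=
  (1 - α • Aᵀ)⁻¹ *ᵥ v

/-- Broadcast total communicability `exp (β A) v`. -/
def expBroadcast (A : Matrix V V ℝ) (v : V → ℝ) (β : ℝ) : V → ℝ :=
  NormedSpace.exp (β • A) *ᵥ v

/-- Receive total communicability `exp (β Aᵀ) v`. -/
def expReceive (A : Matrix V V ℝ) (v : V → ℝ) (β : ℝ) : V → ℝ :=
  NormedSpace.exp (β • Aᵀ) *ᵥ v

/-- The rankings of the nodes given by the score vectors `s t` converge, as `t` runs along the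
filter `l`, to the ranking given by the score vector `w`:
* every strict comparison in the ranking by `w` holds eventually in the ranking by `s t`;
* after a shift and a positive rescaling common to all nodes (which do not change the ranking
  by `s t`), the scores converge to `w`. -/
def RankingsConverge (s : ℝ → V → ℝ) (l : Filter ℝ) (w : V → ℝ) : Prop :=
  (∀ᶠ t in l, ∀ i j, w i < w j → s t i < s t j) ∧
  ∃ a b : ℝ → ℝ, (∀ᶠ t in l, 0 < a t) ∧
    ∀ i, Tendsto (fun t => a t * s t i + b t) l (𝓝 (w i))

end RankingLimits

end

/-!
The adjacency matrix `A` of a strongly connected digraph is irreducible, and so is its transpose, so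
that every statement about the receive centralities is the one about the broadcast centralities for
`Aᵀ`. A strict comparison in the limit ranking follows from the convergence of the rescaled scores
(`rankingsConverge_of_tendsto`), so in each case it suffices to exhibit a normalization.

For small parameters the scores expand to first order as `1 + t A 1 + o(t)`, and `A 1` lists the
out-degrees.

For large parameters, let `r` be the spectral radius, `x` and `y` positive right and left
eigenvectors for it. Existence of the eigenvectors is the Perron–Frobenius theorem
(`exists_pos_eigenvector`, by compactness of the simplex), and a positive eigenvector necessarily
belongs to the spectral radius (`dominantEigenvalue_eq`). Split `v = c x + z` with `y ⬝ z = 0`;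
then `c > 0`.

* The matrix `exp (-r) exp A` has positive entries and fixes `x`, hence it strictly contracts the
  norm `max |z i| / x i` on the vectors orthogonal to `y`
  (`abs_mulVec_le_of_dotProduct_eq_zero`). Therefore `exp (-β r) exp (β A) z` tends to `0`
  (`tendsto_normalizedExp_mulVec_zero`), also for periodic graphs, while `x` is fixed.
* The same decay shows that the eigenvalue `r` is simple, which makes `1 - α A + x yᵀ` invertible
  at `α = 1 / r`. It agrees with `1 - α A` on the vectors orthogonal to `y`, so `(1 - α A)⁻¹ z`
  stays bounded while `(1 - α A)⁻¹ x = x / (1 - α r)` blows up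
  (`katzBroadcast_rankingsConverge_inv`).
-/

namespace RankingLimits

/-! ### Exponentials of nonnegative matrices -/

section Exponential

variable {V : Type*} [Fintype V] [DecidableEq V] {A : Matrix V V ℝ} {x y : V → ℝ} {r : ℝ}

lemma hasSum_exp_apply (A : Matrix V V ℝ) (i j : V) :
    HasSum (fun k : ℕ => ((k.factorial : ℝ)⁻¹) * (A ^ k) i j) (NormedSpace.exp A i j) := by
  open scoped Matrix.Norms.Operator in
  have h := NormedSpace.exp_series_hasSum_exp' (𝕂 := ℝ) A
  exact Pi.hasSum.1 (Pi.hasSum.1 h i) j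

lemma pow_apply_nonneg (hA : ∀ i j, 0 ≤ A i j) (k : ℕ) (i j : V) : 0 ≤ (A ^ k) i j := by
  induction k generalizing i j with
  | zero => rw [pow_zero, one_apply]; split_ifs <;> norm_num
  | succ k ih =>
    rw [pow_succ, mul_apply]
    exact Finset.sum_nonneg fun l _ => mul_nonneg (ih i l) (hA l j)

lemma exp_apply_nonneg (hA : ∀ i j, 0 ≤ A i j) (i j : V) : 0 ≤ NormedSpace.exp A i j :=
  (hasSum_exp_apply A i j).nonneg fun k =>
    mul_nonneg (by positivity) (pow_apply_nonneg hA k i j)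

/-- Every pair of indices is joined by a walk, so some term of the exponential series is positive
there. Unlike a power of `A`, the exponential is positive even when `A` is periodic. -/
lemma exp_apply_pos (hA : A.IsIrreducible) (i j : V) : 0 < NormedSpace.exp A i j := by
  obtain ⟨k, -, hk⟩ := (isIrreducible_iff_exists_pow_pos hA.nonneg).1 hA i j
  refine lt_of_lt_of_le (mul_pos (by positivity) hk)
    (le_hasSum (hasSum_exp_apply A i j) k fun l _ => ?_)
  exact mul_nonneg (by positivity) (pow_apply_nonneg hA.nonneg l i j)

lemma exp_mulVec_eigenvector (hx : A *ᵥ x = r • x) :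
    NormedSpace.exp A *ᵥ x = Real.exp r • x := by
  have hpow : ∀ k : ℕ, A ^ k *ᵥ x = r ^ k • x := by
    intro k
    induction k with
    | zero => simp
    | succ k ih => rw [pow_succ, ← mulVec_mulVec, hx, mulVec_smul, ih, smul_smul, pow_succ']
  ext i
  have h1 : HasSum (fun k : ℕ => ∑ j, ((k.factorial : ℝ)⁻¹ * (A ^ k) i j) * x j)
      (∑ j, NormedSpace.exp A i j * x j) :=
    hasSum_sum fun j _ => (hasSum_exp_apply A i j).mul_right (x j)
  have h2 : HasSum (fun k : ℕ => ((k.factorial : ℝ)⁻¹ * r ^ k) * x i) (Real.exp r * x i) := by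
    have := NormedSpace.exp_series_hasSum_exp' (𝕂 := ℝ) r
    rw [← Real.exp_eq_exp_ℝ] at this
    exact this.mul_right (x i)
  refine h1.unique ?_
  change HasSum _ (Real.exp r * x i)
  convert h2 using 2 with k
  have := congrFun (hpow k) i
  simp only [mulVec, dotProduct, Pi.smul_apply, smul_eq_mul] at this
  simp only [mul_assoc, ← Finset.mul_sum, this]

lemma exp_smul_mulVec_eigenvector (hx : A *ᵥ x = r • x) (β : ℝ) :
    NormedSpace.exp (β • A) *ᵥ x = Real.exp (β * r) • x :=
  exp_mulVec_eigenvector (by rw [smul_mulVec, hx, smul_smul])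

lemma vecMul_exp_smul_eigenvector (hy : y ᵥ* A = r • y) (β : ℝ) :
    y ᵥ* NormedSpace.exp (β • A) = Real.exp (β * r) • y := by
  rw [← mulVec_transpose, ← exp_transpose, transpose_smul]
  exact exp_smul_mulVec_eigenvector (by rw [mulVec_transpose, hy]) β

end Exponential

/-! ### The Perron eigenvector and the spectral radius -/

section Perron

variable {V : Type*} [Fintype V] {A : Matrix V V ℝ} {x y : V → ℝ} {r : ℝ}

lemma dotProduct_pos_of_nonneg_of_ne {x w : V → ℝ} (hx : ∀ i, 0 < x i) (hw : ∀ i, 0 ≤ w i)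
    (hw0 : w ≠ 0) : 0 < x ⬝ᵥ w := by
  obtain ⟨i, hi⟩ := Function.ne_iff.1 hw0
  exact Finset.sum_pos' (fun j _ => mul_nonneg (hx j).le (hw j))
    ⟨i, Finset.mem_univ _, mul_pos (hx i) ((hw i).lt_of_ne' hi)⟩

/-- A vector with positive entries dominates a positive multiple of any other one. -/
lemma exists_pos_smul_le [Nonempty V] {u w : V → ℝ} (hu : ∀ i, 0 < u i) (hw : ∀ i, 0 < w i) :
    ∃ δ > 0, ∀ i, δ * u i ≤ w i := by
  obtain ⟨i, hi⟩ := Finite.exists_min fun i => w i / u i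
  exact ⟨w i / u i, div_pos (hw i) (hu i), fun j => (le_div_iff₀ (hu j)).1 (hi j)⟩

/-- A growth rate realized by some nonnegative vector is at most the eigenvalue of a positive
eigenvector: compare at an index where `w i / x i` is largest. -/
lemma le_of_smul_le_mulVec {w : V → ℝ} {c : ℝ} (hA : ∀ i j, 0 ≤ A i j) (hx : ∀ i, 0 < x i)
    (hAx : A *ᵥ x = r • x) (hw : ∀ i, 0 ≤ w i) (hw0 : w ≠ 0)
    (hc : ∀ i, c * w i ≤ (A *ᵥ w) i) : c ≤ r := by
  obtain ⟨k, hk⟩ := Function.ne_iff.1 hw0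
  have : Nonempty V := ⟨k⟩
  obtain ⟨i, hi⟩ := Finite.exists_max fun i => w i / x i
  have hle : ∀ j, w j ≤ w i / x i * x j := fun j => (div_le_iff₀ (hx j)).1 (hi j)
  have hwi : 0 < w i := by
    have h1 : 0 < w k / x k := div_pos ((hw k).lt_of_ne' hk) (hx k)
    have h2 := h1.trans_le (hi k)
    have h3 := mul_pos h2 (hx i)
    rwa [div_mul_cancel₀ _ (hx i).ne'] at h3
  have h : (A *ᵥ w) i ≤ r * w i := by
    calc (A *ᵥ w) i ≤ (A *ᵥ ((w i / x i) • x)) i :=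
          Finset.sum_le_sum fun j _ => mul_le_mul_of_nonneg_left (hle j) (hA i j)
      _ = r * w i := by
          rw [mulVec_smul, hAx]
          simp only [Pi.smul_apply, smul_eq_mul]
          have := (hx i).ne'
          field_simp
  exact le_of_mul_le_mul_right ((hc i).trans h) hwi

variable [DecidableEq V]

/-- Existence in the Perron–Frobenius theorem. Among the pairs `(r, x)` with `x` in the simplex and
`r x ≤ A x`, take one with `r` largest. If `A x ≠ r x`, applying the positive matrix `exp A`, which
commutes with `A`, makes all the inequalities strict, so that `r` could be increased. -/
theorem exists_pos_eigenvector [Nonempty V] (hA : A.IsIrreducible) :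
    ∃ (r : ℝ) (x : V → ℝ), (∀ i, 0 < x i) ∧ A *ᵥ x = r • x := by
  set M : ℝ := ∑ i, ∑ j, A i j
  have hbound : ∀ s : ℝ, ∀ u ∈ stdSimplex ℝ V, (∀ i, s * u i ≤ (A *ᵥ u) i) → s ≤ M := by
    intro s u hu h
    have h1 : ∑ i, s * u i ≤ ∑ i, (A *ᵥ u) i := Finset.sum_le_sum fun i _ => h i
    rw [← Finset.mul_sum, hu.2, mul_one] at h1
    refine h1.trans (Finset.sum_le_sum fun i _ => Finset.sum_le_sum fun j _ => ?_)
    have hj : u j ≤ 1 := hu.2 ▸ Finset.single_le_sum (fun k _ => hu.1 k) (Finset.mem_univ j)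
    exact mul_le_of_le_one_right (hA.nonneg i j) hj
  let S : Set (ℝ × (V → ℝ)) :=
    (Set.Icc 0 M ×ˢ stdSimplex ℝ V) ∩ {p | ∀ i, p.1 * p.2 i ≤ (A *ᵥ p.2) i}
  have hS : IsCompact S := by
    refine (isCompact_Icc.prod (isCompact_stdSimplex ℝ V)).inter_right ?_
    rw [Set.ofPred_forall]
    refine isClosed_iInter fun i => isClosed_le (by fun_prop) ?_
    exact (continuous_apply i).comp (continuous_const.matrix_mulVec continuous_snd)
  have hne : S.Nonempty := by
    obtain ⟨k⟩ := ‹Nonempty V›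
    have hk : Pi.single k (1 : ℝ) ∈ stdSimplex ℝ V := single_mem_stdSimplex ℝ k
    have h0 : ∀ i, (0 : ℝ) * (Pi.single k (1 : ℝ) : V → ℝ) i ≤ (A *ᵥ Pi.single k 1) i := by
      intro i
      rw [zero_mul]
      exact Finset.sum_nonneg fun j _ => mul_nonneg (hA.nonneg i j) (hk.1 j)
    exact ⟨(0, Pi.single k 1), ⟨⟨⟨le_rfl, hbound 0 _ hk h0⟩, hk⟩, h0⟩⟩
  obtain ⟨⟨r, x⟩, ⟨⟨⟨hr0, -⟩, hxS⟩, hle⟩, hmax⟩ :=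
    hS.exists_isMaxOn hne continuous_fst.continuousOn
  dsimp only at hr0 hxS hle
  set P := NormedSpace.exp A
  have hPpos : ∀ w : V → ℝ, (∀ i, 0 ≤ w i) → w ≠ 0 → ∀ i, 0 < (P *ᵥ w) i :=
    fun w hw hw0 i => dotProduct_pos_of_nonneg_of_ne (exp_apply_pos hA i) hw hw0
  have hx0 : x ≠ 0 := by
    rintro rfl
    simpa using hxS.2
  have hPx := hPpos x hxS.1 hx0
  have heig : A *ᵥ x = r • x := by
    by_contra hcon
    have hPz := hPpos (A *ᵥ x - r • x) (fun i => by simpa using hle i) (sub_ne_zero.2 hcon)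
    have hcomm : P *ᵥ (A *ᵥ x - r • x) = A *ᵥ (P *ᵥ x) - r • (P *ᵥ x) := by
      have : Commute A P := by
        open scoped Matrix.Norms.Operator in
        exact (Commute.refl A).exp_right
      rw [mulVec_sub, mulVec_smul, mulVec_mulVec, mulVec_mulVec, this.eq]
    obtain ⟨δ, hδ, hδle⟩ := exists_pos_smul_le hPx hPz
    set c : ℝ := ∑ i, (P *ᵥ x) i
    have hc : 0 < c := Finset.sum_pos (fun i _ => hPx i) Finset.univ_nonempty
    have hu : c⁻¹ • (P *ᵥ x) ∈ stdSimplex ℝ V := by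
      refine ⟨fun i => mul_nonneg (inv_nonneg.2 hc.le) (hPx i).le, ?_⟩
      simp only [Pi.smul_apply, smul_eq_mul, ← Finset.mul_sum]
      exact inv_mul_cancel₀ hc.ne'
    have hule : ∀ i, (r + δ) * (c⁻¹ • (P *ᵥ x)) i ≤ (A *ᵥ (c⁻¹ • (P *ᵥ x))) i := by
      intro i
      have h1 := hδle i
      rw [hcomm] at h1
      rw [mulVec_smul]
      simp only [Pi.sub_apply, Pi.smul_apply, smul_eq_mul] at h1 ⊢
      rw [mul_left_comm]
      exact mul_le_mul_of_nonneg_left (by linarith) (inv_nonneg.2 hc.le)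
    have := hmax (show (r + δ, c⁻¹ • (P *ᵥ x)) ∈ S from
      ⟨⟨⟨by positivity, hbound _ _ hu hule⟩, hu⟩, hule⟩)
    simp only [Set.mem_ofPred_eq] at this
    linarith
  refine ⟨r, x, fun i => ?_, heig⟩
  have h := hPx i
  rw [exp_mulVec_eigenvector heig] at h
  exact pos_of_mul_pos_right h (Real.exp_pos r).le

/-- A positive eigenvector belongs to the spectral radius. -/
theorem dominantEigenvalue_eq [Nonempty V] (hA : ∀ i j, 0 ≤ A i j) (hx : ∀ i, 0 < x i)
    (hAx : A *ᵥ x = r • x) : dominantEigenvalue A = r := by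
  obtain ⟨k⟩ := ‹Nonempty V›
  have hr : 0 ≤ r := by
    have h : 0 ≤ r * x k := by
      have := congrFun hAx k
      rw [Pi.smul_apply, smul_eq_mul] at this
      rw [← this]
      exact Finset.sum_nonneg fun j _ => mul_nonneg (hA k j) (hx j).le
    exact nonneg_of_mul_nonneg_left h (hx k)
  set B : Matrix V V ℂ := A.map (fun a : ℝ => (a : ℂ))
  have hspec : ∀ μ : ℂ, μ ∈ spectrum ℂ B ↔ ∃ z : V → ℂ, z ≠ 0 ∧ B *ᵥ z = μ • z := by
    intro μ
    rw [spectrum.mem_iff, isUnit_iff_isUnit_det, isUnit_iff_ne_zero, not_not,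
      ← exists_mulVec_eq_zero_iff]
    refine exists_congr fun z => and_congr_right fun _ => ?_
    rw [sub_mulVec, Algebra.algebraMap_eq_smul_one, smul_mulVec, one_mulVec, sub_eq_zero, eq_comm]
  have hmem : (r : ℂ) ∈ spectrum ℂ B := by
    refine (hspec r).2 ⟨fun i => (x i : ℂ), fun h => ?_, ?_⟩
    · exact (hx k).ne' (by simpa using congrFun h k)
    · ext i
      have := congrArg (fun a : ℝ => (a : ℂ)) (congrFun hAx i)
      simpa [mulVec, dotProduct, B] using this
  have hrad : spectralRadius ℂ B = ENNReal.ofReal r := by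
    refine le_antisymm (iSup₂_le fun μ hμ => ?_) ?_
    · obtain ⟨z, hz0, hz⟩ := (hspec μ).1 hμ
      have : ‖μ‖ ≤ r := by
        refine le_of_smul_le_mulVec (w := fun i => ‖z i‖) hA hx hAx (fun i => norm_nonneg _)
          (fun h => hz0 (funext fun i => norm_eq_zero.1 (congrFun h i))) fun i => ?_
        have h1 := congrFun hz i
        rw [Pi.smul_apply, smul_eq_mul] at h1
        rw [← norm_mul, ← h1]
        refine (norm_sum_le _ _).trans (Finset.sum_le_sum fun j _ => ?_)
        rw [norm_mul]
        simp [B, abs_of_nonneg (hA i j)]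
      rw [← enorm_eq_nnnorm, ← ofReal_norm]
      exact ENNReal.ofReal_le_ofReal this
    · have h := le_iSup₂ (f := fun (μ : ℂ) (_ : μ ∈ spectrum ℂ B) => (‖μ‖₊ : ENNReal)) (r : ℂ) hmem
      rw [← enorm_eq_nnnorm, ← ofReal_norm, Complex.norm_real, Real.norm_of_nonneg hr] at h
      exact h
  rw [dominantEigenvalue, hrad, ENNReal.toReal_ofReal hr]

theorem exists_isDominantRightEigenvector [Nonempty V] (hA : A.IsIrreducible) :
    ∃ x, IsDominantRightEigenvector A x := by
  obtain ⟨r, x, hx, hAx⟩ := exists_pos_eigenvector hA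
  exact ⟨x, hx, by rw [hAx, dominantEigenvalue_eq hA.nonneg hx hAx]⟩

/-- Pairing a positive right with a positive left eigenvector shows that their eigenvalues agree. -/
lemma dominantEigenvalue_transpose [Nonempty V] (hA : A.IsIrreducible) :
    dominantEigenvalue Aᵀ = dominantEigenvalue A := by
  obtain ⟨x, hx, hAx⟩ := exists_isDominantRightEigenvector hA
  obtain ⟨y, hy, hAy⟩ := exists_isDominantRightEigenvector hA.transpose
  have hpos : 0 < y ⬝ᵥ x := dotProduct_pos_of_nonneg_of_ne hy (fun i => (hx i).le)
    (fun h => (hx (Classical.arbitrary V)).ne' (congrFun h _))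
  have h := dotProduct_mulVec y A x
  rw [hAx, ← mulVec_transpose, hAy, dotProduct_smul, smul_dotProduct] at h
  exact (mul_right_cancel₀ hpos.ne' h).symm

lemma isDominantRightEigenvector_transpose [Nonempty V] (hA : A.IsIrreducible) :
    IsDominantRightEigenvector Aᵀ y ↔ IsDominantLeftEigenvector A y := by
  rw [IsDominantRightEigenvector, IsDominantLeftEigenvector, mulVec_transpose,
    dominantEigenvalue_transpose hA]

lemma dominantEigenvalue_pos [Nontrivial V] (hA : A.IsIrreducible) :
    0 < dominantEigenvalue A := by
  obtain ⟨x, hx, hAx⟩ := exists_isDominantRightEigenvector hA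
  obtain ⟨i⟩ := (inferInstance : Nonempty V)
  obtain ⟨j, hj⟩ := hA.exists_pos i
  have h : 0 < dominantEigenvalue A * x i := by
    have := congrFun hAx i
    rw [Pi.smul_apply, smul_eq_mul] at this
    rw [← this]
    exact Finset.sum_pos' (fun k _ => mul_nonneg (hA.nonneg i k) (hx k).le)
      ⟨j, Finset.mem_univ _, mul_pos hj (hx j)⟩
  exact pos_of_mul_pos_left h (hx i).le

lemma isUnit_one_sub_smul (hA : ∀ i j, 0 ≤ A i j) (hx : ∀ i, 0 < x i) (hAx : A *ᵥ x = r • x)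
    (hr : 0 < r) {α : ℝ} (hα : 0 < α) (hα' : α < 1 / r) : IsUnit (1 - α • A) := by
  rw [isUnit_iff_isUnit_det, isUnit_iff_ne_zero]
  intro hdet
  obtain ⟨z, hz0, hz⟩ := exists_mulVec_eq_zero_iff.2 hdet
  rw [sub_mulVec, one_mulVec, smul_mulVec, sub_eq_zero] at hz
  have : 1 / α ≤ r := by
    refine le_of_smul_le_mulVec (w := fun i => |z i|) hA hx hAx (fun i => abs_nonneg _)
      (fun h => hz0 (funext fun i => abs_eq_zero.1 (congrFun h i))) fun i => ?_
    have h1 := congrFun hz i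
    rw [Pi.smul_apply, smul_eq_mul] at h1
    rw [h1, abs_mul, abs_of_pos hα, ← mul_assoc, one_div, inv_mul_cancel₀ hα.ne', one_mul]
    refine (Finset.abs_sum_le_sum_abs _ _).trans (Finset.sum_le_sum fun j _ => ?_)
    rw [abs_mul, abs_of_nonneg (hA i j)]
  rw [lt_div_iff₀ hr] at hα'
  rw [div_le_iff₀ hα] at this
  linarith

end Perron

/-! ### Convergence of rankings -/

section Rankings

variable {V : Type*} [Fintype V]

/-- A positive rescaling and a shift do not change the order of the scores, so convergence of the
normalized scores already forces the strict comparisons, of which there are finitely many. -/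
lemma rankingsConverge_of_tendsto {s : ℝ → V → ℝ} {l : Filter ℝ} {w : V → ℝ} (a b : ℝ → ℝ)
    (ha : ∀ᶠ t in l, 0 < a t)
    (h : ∀ i, Tendsto (fun t => a t * s t i + b t) l (𝓝 (w i))) : RankingsConverge s l w := by
  refine ⟨?_, a, b, ha, h⟩
  simp only [eventually_all]
  intro i j hij
  filter_upwards [ha, (h i).eventually_lt (h j) hij] with t hat ht
  exact lt_of_mul_lt_mul_left (lt_of_add_lt_add_right ht) hat.le

end Rankings

/-! ### Small parameters -/

section SmallParameters

variable {V : Type*} [Fintype V] [DecidableEq V]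

lemma tendsto_inv_mulVec {l : Filter ℝ} {N : ℝ → Matrix V V ℝ} {N₀ : Matrix V V ℝ}
    (hN : Tendsto N l (𝓝 N₀)) (hdet : IsUnit N₀) (z : V → ℝ) :
    Tendsto (fun t => (N t)⁻¹ *ᵥ z) l (𝓝 (N₀⁻¹ *ᵥ z)) := by
  have h : ContinuousAt Inv.inv N₀ := by
    refine continuousAt_matrix_inv N₀ ?_
    have := NormedRing.inverse_continuousAt ((isUnit_iff_isUnit_det _).1 hdet).unit
    rwa [IsUnit.unit_spec] at this
  exact ((continuous_id.matrix_mulVec continuous_const).tendsto _).comp (h.tendsto.comp hN)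

/-- The first-order term of `(1 - α A)⁻¹ 1` is `A 1`: exactly,
`α⁻¹ ((1 - α A)⁻¹ 1 - 1) = (1 - α A)⁻¹ A 1`. -/
theorem katzBroadcast_rankingsConverge_zero (A : Matrix V V ℝ) :
    RankingsConverge (katzBroadcast A 1) (𝓝[>] 0) (A *ᵥ 1) := by
  have hN : Tendsto (fun α : ℝ => 1 - α • A) (𝓝[>] 0) (𝓝 1) := by
    have : Continuous fun α : ℝ => 1 - α • A := by fun_prop
    simpa using (this.tendsto 0).mono_left nhdsWithin_le_nhds
  have hpos : ∀ᶠ α : ℝ in 𝓝[>] 0, 0 < α := eventually_mem_nhdsWithin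
  have hunit : ∀ᶠ α : ℝ in 𝓝[>] 0, (1 - α • A).det ≠ 0 := by
    have := (continuous_id.matrix_det.tendsto (1 : Matrix V V ℝ)).comp hN
    exact this.eventually_ne (by simp)
  have hlim := tendsto_inv_mulVec hN isUnit_one (A *ᵥ 1)
  rw [inv_one, one_mulVec] at hlim
  refine rankingsConverge_of_tendsto (fun α => α⁻¹) (fun α => -α⁻¹)
    (hpos.mono fun α => inv_pos.2) fun i => ?_
  refine (tendsto_pi_nhds.1 hlim i).congr' ?_
  filter_upwards [hpos, hunit] with α hα hdet
  have key : α • ((1 - α • A)⁻¹ *ᵥ (A *ᵥ 1)) = katzBroadcast A 1 α - 1 := by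
    have h1 : α • (A *ᵥ (1 : V → ℝ)) = 1 - (1 - α • A) *ᵥ 1 := by
      rw [sub_mulVec, one_mulVec, smul_mulVec, sub_sub_cancel]
    rw [← mulVec_smul, h1, mulVec_sub, mulVec_mulVec,
      nonsing_inv_mul _ (isUnit_iff_ne_zero.2 hdet), one_mulVec, katzBroadcast]
  have := congrFun key i
  simp only [Pi.smul_apply, smul_eq_mul, Pi.sub_apply, Pi.one_apply] at this
  rw [eq_add_neg_iff_add_eq, eq_comm, ← sub_eq_iff_eq_add]
  have hα' := hα.ne'
  field_simp
  linarith

/-- The derivative of `exp (β A) 1` at `β = 0` is `A 1`. -/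
theorem expBroadcast_rankingsConverge_zero (A : Matrix V V ℝ) :
    RankingsConverge (expBroadcast A 1) (𝓝[>] 0) (A *ᵥ 1) := by
  have hpos : ∀ᶠ β : ℝ in 𝓝[>] 0, 0 < β := eventually_mem_nhdsWithin
  have hmat : Tendsto (fun β : ℝ => β⁻¹ • (NormedSpace.exp (β • A) - 1)) (𝓝[>] 0) (𝓝 A) := by
    open scoped Matrix.Norms.Operator in
    have h := (hasDerivAt_exp_smul_const A (0 : ℝ)).tendsto_slope_zero_right
    simp only [zero_add, zero_smul, NormedSpace.exp_zero, one_mul] at h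
    exact h
  have hvec := ((continuous_id.matrix_mulVec (continuous_const (y := (1 : V → ℝ)))).tendsto A).comp
    hmat
  refine rankingsConverge_of_tendsto (fun β => β⁻¹) (fun β => -β⁻¹)
    (hpos.mono fun β => inv_pos.2) fun i => (tendsto_pi_nhds.1 hvec i).congr fun β => ?_
  simp only [Function.comp_apply, id, smul_mulVec, sub_mulVec, one_mulVec, Pi.smul_apply,
    Pi.sub_apply, Pi.one_apply, smul_eq_mul, expBroadcast]
  ring

end SmallParameters

/-! ### Large parameters -/

section LargeParameters

variable {V : Type*} [Fintype V] {A Q : Matrix V V ℝ} {x y z v : V → ℝ} {r : ℝ}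

/-- If `Q` fixes `x` and dominates `ε x yᵀ`, then on vectors orthogonal to `y` it acts like the
nonnegative matrix `Q - ε x yᵀ`, which scales `x` by `1 - ε y ⬝ x`. Hence it contracts the norm
`max |z i| / x i` by that factor. -/
lemma abs_mulVec_le_of_dotProduct_eq_zero {ε C : ℝ} (hQ : ∀ i j, ε * x i * y j ≤ Q i j)
    (hQx : Q *ᵥ x = x) (hz : y ⬝ᵥ z = 0) (hC : ∀ i, |z i| ≤ C * x i) (i : V) :
    |(Q *ᵥ z) i| ≤ (1 - ε * (y ⬝ᵥ x)) * C * x i := by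
  have hsub : ∀ u : V → ℝ,
      ∑ j, (Q i j - ε * x i * y j) * u j = (Q *ᵥ u) i - ε * x i * (y ⬝ᵥ u) := by
    intro u
    simp only [sub_mul, Finset.sum_sub_distrib, mulVec, dotProduct, Finset.mul_sum, mul_assoc]
  have h1 : (Q *ᵥ z) i = ∑ j, (Q i j - ε * x i * y j) * z j := by rw [hsub, hz]; ring
  calc |(Q *ᵥ z) i| ≤ ∑ j, |(Q i j - ε * x i * y j) * z j| := by
        rw [h1]; exact Finset.abs_sum_le_sum_abs _ _
    _ ≤ ∑ j, (Q i j - ε * x i * y j) * (C * x j) := by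
        refine Finset.sum_le_sum fun j _ => ?_
        rw [abs_mul, abs_of_nonneg (sub_nonneg.2 (hQ i j))]
        exact mul_le_mul_of_nonneg_left (hC j) (sub_nonneg.2 (hQ i j))
    _ = C * ∑ j, (Q i j - ε * x i * y j) * x j := by
        rw [Finset.mul_sum]; exact Finset.sum_congr rfl fun j _ => by ring
    _ = (1 - ε * (y ⬝ᵥ x)) * C * x i := by rw [hsub, hQx]; ring

lemma dotProduct_pos [Nonempty V] (hy : ∀ i, 0 < y i) (hx : ∀ i, 0 < x i) : 0 < y ⬝ᵥ x :=
  Finset.sum_pos (fun j _ => mul_pos (hy j) (hx j)) Finset.univ_nonempty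

lemma exists_abs_le_mul [Nonempty V] (hx : ∀ i, 0 < x i) (z : V → ℝ) :
    ∃ C, 0 ≤ C ∧ ∀ i, |z i| ≤ C * x i := by
  obtain ⟨i, hi⟩ := Finite.exists_max fun i => |z i| / x i
  exact ⟨|z i| / x i, div_nonneg (abs_nonneg _) (hx i).le, fun j => (div_le_iff₀ (hx j)).1 (hi j)⟩

variable [DecidableEq V]

/-- The exponential `exp (β A)`, normalized so that it fixes the eigenvectors of `A` for `r`. -/
noncomputable def normalizedExp (A : Matrix V V ℝ) (r β : ℝ) : Matrix V V ℝ :=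
  Real.exp (-(β * r)) • NormedSpace.exp (β • A)

lemma normalizedExp_add (A : Matrix V V ℝ) (r β γ : ℝ) :
    normalizedExp A r (β + γ) = normalizedExp A r β * normalizedExp A r γ := by
  have h : Commute (β • A) (γ • A) := ((Commute.refl A).smul_left β).smul_right γ
  rw [normalizedExp, normalizedExp, normalizedExp, add_smul, exp_add_of_commute _ _ h,
    smul_mul_smul_comm, ← Real.exp_add]
  congr 2
  ring

lemma normalizedExp_mulVec (hAx : A *ᵥ x = r • x) (β : ℝ) : normalizedExp A r β *ᵥ x = x := by
  rw [normalizedExp, smul_mulVec, exp_smul_mulVec_eigenvector hAx, smul_smul, ← Real.exp_add,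
    neg_add_cancel, Real.exp_zero, one_smul]

lemma vecMul_normalizedExp (hAy : y ᵥ* A = r • y) (β : ℝ) : y ᵥ* normalizedExp A r β = y := by
  rw [normalizedExp, vecMul_smul, vecMul_exp_smul_eigenvector hAy, smul_smul, ← Real.exp_add,
    neg_add_cancel, Real.exp_zero, one_smul]

lemma normalizedExp_nonneg (hA : ∀ i j, 0 ≤ A i j) {β : ℝ} (hβ : 0 ≤ β) (i j : V) :
    0 ≤ normalizedExp A r β i j :=
  mul_nonneg (Real.exp_pos _).le (exp_apply_nonneg (fun i j => mul_nonneg hβ (hA i j)) i j)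

/-- On vectors orthogonal to the left eigenvector the normalized exponential decays: unit time
steps contract by a factor `ρ < 1` because `exp A` is positive, and fractional steps do not
expand. -/
theorem tendsto_normalizedExp_mulVec_zero [Nonempty V] (hA : A.IsIrreducible)
    (hx : ∀ i, 0 < x i) (hAx : A *ᵥ x = r • x) (hy : ∀ i, 0 < y i) (hAy : y ᵥ* A = r • y)
    (hz : y ⬝ᵥ z = 0) (i : V) :
    Tendsto (fun β => (normalizedExp A r β *ᵥ z) i) atTop (𝓝 0) := by
  set E := normalizedExp A r
  have hyx := dotProduct_pos hy hx
  have hE1 : ∀ i j, 0 < E 1 i j := by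
    intro i j
    have := exp_apply_pos hA i j
    simp only [E, normalizedExp, one_smul, Matrix.smul_apply, smul_eq_mul]
    exact mul_pos (Real.exp_pos _) this
  obtain ⟨ε, hε, hεle⟩ := exists_pos_smul_le (V := V × V) (u := fun p => x p.1 * y p.2)
    (w := fun p => E 1 p.1 p.2) (fun p => mul_pos (hx _) (hy _)) (fun p => hE1 _ _)
  obtain ⟨C, hC0, hC⟩ := exists_abs_le_mul hx z
  set ρ := 1 - ε * (y ⬝ᵥ x)
  have hρ1 : ρ < 1 := sub_lt_self _ (mul_pos hε hyx)
  have hEle : ∀ i j, ε * x i * y j ≤ E 1 i j := fun i j => by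
    simpa only [mul_assoc] using hεle (i, j)
  have hρ0 : 0 ≤ ρ := by
    -- `ρ * x i` is the value at `x` of the nonnegative matrix `E 1 - ε x yᵀ`.
    have h1 : ∑ j, ε * x i * y j * x j ≤ (E 1 *ᵥ x) i :=
      Finset.sum_le_sum fun j _ => mul_le_mul_of_nonneg_right (hEle i j) (hx j).le
    rw [normalizedExp_mulVec hAx] at h1
    have h2 : ∑ j, ε * x i * y j * x j = ε * (y ⬝ᵥ x) * x i := by
      simp only [dotProduct, Finset.mul_sum, Finset.sum_mul]
      exact Finset.sum_congr rfl fun j _ => by ring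
    rw [h2] at h1
    exact nonneg_of_mul_nonneg_left (by simp only [ρ]; linarith) (hx i)
  have horth : ∀ β, y ⬝ᵥ (E β *ᵥ z) = 0 := fun β => by
    rw [dotProduct_mulVec, vecMul_normalizedExp hAy, hz]
  have hnat : ∀ (k : ℕ) (j : V), |(E k *ᵥ z) j| ≤ ρ ^ k * C * x j := by
    intro k
    induction k with
    | zero =>
      intro j
      simpa [E, normalizedExp] using hC j
    | succ k ih =>
      intro j
      have := abs_mulVec_le_of_dotProduct_eq_zero hEle (normalizedExp_mulVec hAx 1) (horth k) ih j
      rw [mulVec_mulVec, ← normalizedExp_add] at this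
      rw [Nat.cast_succ, add_comm (k : ℝ) 1, pow_succ', mul_assoc ρ]
      exact this
  have hreal : ∀ β : ℝ, 0 ≤ β → |(E β *ᵥ z) i| ≤ ρ ^ ⌊β⌋₊ * C * x i := by
    intro β hβ
    have hfrac : 0 ≤ β - ⌊β⌋₊ := sub_nonneg.2 (Nat.floor_le hβ)
    have := abs_mulVec_le_of_dotProduct_eq_zero (ε := 0)
      (fun i j => by simpa using normalizedExp_nonneg (r := r) hA.nonneg hfrac i j)
      (normalizedExp_mulVec hAx _) (horth ⌊β⌋₊) (hnat ⌊β⌋₊) i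
    rw [mulVec_mulVec, ← normalizedExp_add, sub_add_cancel] at this
    simpa using this
  have hlim : Tendsto (fun β : ℝ => ρ ^ ⌊β⌋₊ * C * x i) atTop (𝓝 0) := by
    have := ((tendsto_pow_atTop_nhds_zero_of_lt_one hρ0 hρ1).comp
      (tendsto_nat_floor_atTop (α := ℝ))).mul_const C |>.mul_const (x i)
    simpa using this
  exact squeeze_zero_norm' ((eventually_ge_atTop 0).mono hreal) hlim

/-- Split `v = c x + z` with `z` orthogonal to `y`. The normalized exponential fixes `c x`, where
`c > 0` because `y` and `v` are positive, and makes `z` decay. -/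
theorem expBroadcast_rankingsConverge_atTop [Nonempty V] (hA : A.IsIrreducible)
    (hx : ∀ i, 0 < x i) (hAx : A *ᵥ x = r • x) (hy : ∀ i, 0 < y i) (hAy : y ᵥ* A = r • y)
    (hv : ∀ i, 0 < v i) : RankingsConverge (expBroadcast A v) atTop x := by
  have hyx := dotProduct_pos hy hx
  set c := (y ⬝ᵥ v) / (y ⬝ᵥ x)
  have hc : 0 < c := div_pos (dotProduct_pos hy hv) hyx
  have hz : y ⬝ᵥ (v - c • x) = 0 := by
    rw [dotProduct_sub, dotProduct_smul, smul_eq_mul, div_mul_cancel₀ _ hyx.ne', sub_self]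
  refine rankingsConverge_of_tendsto (fun β => c⁻¹ * Real.exp (-(β * r))) 0
    (.of_forall fun β => by positivity) fun i => ?_
  have h := ((tendsto_normalizedExp_mulVec_zero hA hx hAx hy hAy hz i).const_mul c⁻¹).add_const
    (x i)
  rw [mul_zero, zero_add] at h
  refine h.congr fun β => ?_
  rw [mulVec_sub, mulVec_smul, normalizedExp_mulVec hAx]
  simp only [normalizedExp, smul_mulVec, expBroadcast, Pi.sub_apply, Pi.smul_apply, smul_eq_mul,
    Pi.zero_apply]
  field_simp
  ring

/-- The eigenvalue `r` is simple. -/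
lemma eq_zero_of_mulVec_eq_of_dotProduct_eq_zero [Nonempty V] (hA : A.IsIrreducible)
    (hx : ∀ i, 0 < x i) (hAx : A *ᵥ x = r • x) (hy : ∀ i, 0 < y i) (hAy : y ᵥ* A = r • y)
    (hAz : A *ᵥ z = r • z) (hz : y ⬝ᵥ z = 0) : z = 0 := by
  ext i
  have h := tendsto_normalizedExp_mulVec_zero hA hx hAx hy hAy hz i
  simp only [normalizedExp_mulVec hAz] at h
  exact tendsto_nhds_unique tendsto_const_nhds h

/-- Write `v = c x + z` with `z` orthogonal to `y`. The `x` part of `(1 - α A)⁻¹ v` is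
`c / (1 - α r) x`, which blows up. On vectors orthogonal to `y` one may replace `1 - α A` by
`1 - α A + x yᵀ`, which stays invertible at `α = 1 / r`, so the `z` part stays bounded. -/
theorem katzBroadcast_rankingsConverge_inv [Nonempty V] (hA : A.IsIrreducible) (hr : 0 < r)
    (hx : ∀ i, 0 < x i) (hAx : A *ᵥ x = r • x) (hy : ∀ i, 0 < y i) (hAy : y ᵥ* A = r • y)
    (hv : ∀ i, 0 < v i) : RankingsConverge (katzBroadcast A v) (𝓝[<] (1 / r)) x := by
  have hyx := dotProduct_pos hy hx
  set c := (y ⬝ᵥ v) / (y ⬝ᵥ x)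
  have hc : 0 < c := div_pos (dotProduct_pos hy hv) hyx
  set z := v - c • x
  have hz : y ⬝ᵥ z = 0 := by
    rw [dotProduct_sub, dotProduct_smul, smul_eq_mul, div_mul_cancel₀ _ hyx.ne', sub_self]
  let N : ℝ → Matrix V V ℝ := fun α => 1 - α • A + vecMulVec x y
  have hNapply : ∀ α w, N α *ᵥ w = w - α • (A *ᵥ w) + (y ⬝ᵥ w) • x := by
    intro α w
    simp only [N, add_mulVec, sub_mulVec, one_mulVec, smul_mulVec, vecMulVec_mulVec]
    simp
  have hNorth : ∀ α, α * r ≤ 1 → ∀ w, y ⬝ᵥ (N α *ᵥ w) = 0 → y ⬝ᵥ w = 0 := by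
    intro α hα w hw
    have h1 : y ⬝ᵥ (N α *ᵥ w) = (1 - α * r + y ⬝ᵥ x) * (y ⬝ᵥ w) := by
      rw [hNapply, dotProduct_add, dotProduct_sub, dotProduct_smul, dotProduct_smul,
        dotProduct_mulVec, hAy, smul_dotProduct]
      simp only [smul_eq_mul]
      ring
    rw [h1] at hw
    exact (mul_eq_zero.1 hw).resolve_left (by linarith)
  have hN : Tendsto N (𝓝[<] (1 / r)) (𝓝 (N (1 / r))) := by
    have : Continuous N := by fun_prop
    exact (this.tendsto _).mono_left nhdsWithin_le_nhds
  have hunit : IsUnit (N (1 / r)) := by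
    rw [isUnit_iff_isUnit_det, isUnit_iff_ne_zero]
    intro hdet
    obtain ⟨w, hw0, hw⟩ := exists_mulVec_eq_zero_iff.2 hdet
    have hyw := hNorth (1 / r) (by rw [one_div_mul_cancel hr.ne']) w (by rw [hw, dotProduct_zero])
    rw [hNapply, hyw, zero_smul, add_zero, sub_eq_zero] at hw
    refine hw0 (eq_zero_of_mulVec_eq_of_dotProduct_eq_zero hA hx hAx hy hAy ?_ hyw)
    conv_rhs => rw [hw]
    rw [smul_smul, mul_one_div_cancel hr.ne', one_smul]
  have hdet : ∀ᶠ α in 𝓝[<] (1 / r), (N α).det ≠ 0 := by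
    have := (continuous_id.matrix_det.tendsto (N (1 / r))).comp hN
    exact this.eventually_ne (isUnit_iff_ne_zero.1 ((isUnit_iff_isUnit_det _).1 hunit))
  have hlt : ∀ᶠ α in 𝓝[<] (1 / r), α < 1 / r := eventually_mem_nhdsWithin
  have hpos : ∀ᶠ α in 𝓝[<] (1 / r), 0 < α :=
    nhdsWithin_le_nhds (lt_mem_nhds (one_div_pos.2 hr))
  have hgap : ∀ α, α < 1 / r → 0 < 1 - α * r := fun α hα => by
    rw [lt_div_iff₀ hr] at hα
    linarith
  refine rankingsConverge_of_tendsto (fun α => c⁻¹ * (1 - α * r)) 0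
    (hlt.mono fun α hα => mul_pos (inv_pos.2 hc) (hgap α hα)) fun i => ?_
  have hscale : Tendsto (fun α => c⁻¹ * (1 - α * r)) (𝓝[<] (1 / r)) (𝓝 0) := by
    have : Continuous fun α => c⁻¹ * (1 - α * r) := by fun_prop
    have h := (this.tendsto (1 / r)).mono_left (nhdsWithin_le_nhds (s := Set.Iio (1 / r)))
    rwa [one_div_mul_cancel hr.ne', sub_self, mul_zero] at h
  have h := (hscale.mul (tendsto_pi_nhds.1 (tendsto_inv_mulVec hN hunit z) i)).const_add (x i)
  rw [zero_mul, add_zero] at h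
  refine h.congr' ?_
  filter_upwards [hlt, hpos, hdet] with α hα hα0 hd
  set w := (N α)⁻¹ *ᵥ z
  have hg := hgap α hα
  have hNw : N α *ᵥ w = z := by
    rw [mulVec_mulVec, mul_nonsing_inv _ (isUnit_iff_ne_zero.2 hd), one_mulVec]
  have hyw : y ⬝ᵥ w = 0 := hNorth α (by linarith) w (by rw [hNw, hz])
  have hkatz : katzBroadcast A v α = (c / (1 - α * r)) • x + w := by
    have hU := isUnit_one_sub_smul hA.nonneg hx hAx hr hα0 hα
    have hsolve : (1 - α • A) *ᵥ ((c / (1 - α * r)) • x + w) = v := by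
      have h1 : (1 - α • A) *ᵥ x = (1 - α * r) • x := by
        rw [sub_mulVec, one_mulVec, smul_mulVec, hAx, smul_smul, sub_smul, one_smul]
      have h2 : (1 - α • A) *ᵥ w = z := by
        rw [← hNw, hNapply, hyw, zero_smul, add_zero, sub_mulVec, one_mulVec, smul_mulVec]
      rw [mulVec_add, mulVec_smul, h1, h2, smul_smul, div_mul_cancel₀ _ hg.ne',
        add_sub_cancel]
    rw [katzBroadcast]
    conv_lhs => rw [← hsolve]
    rw [mulVec_mulVec, nonsing_inv_mul _ ((isUnit_iff_isUnit_det _).1 hU), one_mulVec]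
  rw [hkatz]
  simp only [Pi.add_apply, Pi.smul_apply, smul_eq_mul, Pi.zero_apply, add_zero]
  field_simp

end LargeParameters

/-! ### Adjacency matrices of strongly connected digraphs -/

section Adjacency

variable {V : Type*} {G : Digraph V}

lemma adjacency_pos_iff {i j : V} : 0 < adjacency G i j ↔ G.Adj i j := by
  by_cases h : G.Adj i j <;> simp [adjacency, h]

lemma adjacency_nonneg (G : Digraph V) (i j : V) : 0 ≤ adjacency G i j := by
  by_cases h : G.Adj i j <;> simp [adjacency, h]

variable [Fintype V]

lemma adjacency_mulVec_one (G : Digraph V) :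
    adjacency G *ᵥ 1 = fun i => (outDegree G i : ℝ) := by
  classical
  ext i
  simp [mulVec, dotProduct, adjacency, outDegree, Set.ncard_eq_toFinset_card']

lemma adjacency_transpose_mulVec_one (G : Digraph V) :
    (adjacency G)ᵀ *ᵥ 1 = fun i => (inDegree G i : ℝ) := by
  classical
  ext i
  simp [mulVec, dotProduct, adjacency, inDegree, Set.ncard_eq_toFinset_card']

/-- Irreducibility asks for closed walks of positive length too; these exist because a walk can
leave `i` for another node and come back. -/
lemma StronglyConnected.adjacency_isIrreducible [DecidableEq V] [Nontrivial V]
    (hG : StronglyConnected G) : (adjacency G).IsIrreducible := by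
  rw [isIrreducible_iff_exists_pow_pos (adjacency_nonneg G)]
  have hwalk : ∀ i j, Relation.TransGen G.Adj i j → ∃ k, 0 < k ∧ 0 < (adjacency G ^ k) i j := by
    intro i j h
    induction h with
    | single h => exact ⟨1, one_pos, by rw [pow_one]; exact adjacency_pos_iff.2 h⟩
    | @tail b d _ h ih =>
      obtain ⟨k, -, hk⟩ := ih
      refine ⟨k + 1, k.succ_pos, ?_⟩
      rw [pow_succ, mul_apply]
      exact Finset.sum_pos' (fun l _ => mul_nonneg
        (pow_apply_nonneg (adjacency_nonneg G) k i l) (adjacency_nonneg G l d))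
        ⟨b, Finset.mem_univ _, mul_pos hk (adjacency_pos_iff.2 h)⟩
  have hne : ∀ i j, i ≠ j → Relation.TransGen G.Adj i j := fun i j hij =>
    (Relation.reflTransGen_iff_eq_or_transGen.1 (hG i j)).resolve_left hij.symm
  intro i j
  refine hwalk i j ?_
  rcases eq_or_ne i j with rfl | hij
  · obtain ⟨k, hk⟩ := exists_ne i
    exact (hne i k hk.symm).trans (hne k i hk)
  · exact hne i j hij

end Adjacency

end RankingLimits

theorem corollary5p5 {V : Type*} [Fintype V] [DecidableEq V] [Nontrivial V]
    (G : Digraph V) (hG : RankingLimits.StronglyConnected G)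
    (A : Matrix V V ℝ) (hA : A = RankingLimits.adjacency G)
    (lam₁ : ℝ) (hlam₁ : lam₁ = RankingLimits.dominantEigenvalue A) :
    -- the objects are well defined
    (0 < lam₁ ∧
      (∀ α : ℝ, 0 < α → α < 1 / lam₁ → IsUnit (1 - α • A) ∧ IsUnit (1 - α • Aᵀ)) ∧
      (∃ x : V → ℝ, RankingLimits.IsDominantRightEigenvector A x) ∧
      (∃ y : V → ℝ, RankingLimits.IsDominantLeftEigenvector A y)) ∧
    -- small parameters, with the vector of all ones
    (RankingLimits.RankingsConverge (RankingLimits.katzBroadcast A 1) (𝓝[>] 0)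
        (fun i => (RankingLimits.outDegree G i : ℝ)) ∧
      RankingLimits.RankingsConverge (RankingLimits.katzReceive A 1) (𝓝[>] 0)
        (fun i => (RankingLimits.inDegree G i : ℝ)) ∧
      RankingLimits.RankingsConverge (RankingLimits.expBroadcast A 1) (𝓝[>] 0)
        (fun i => (RankingLimits.outDegree G i : ℝ)) ∧
      RankingLimits.RankingsConverge (RankingLimits.expReceive A 1) (𝓝[>] 0)
        (fun i => (RankingLimits.inDegree G i : ℝ))) ∧
    -- large parameters, with an arbitrary positive preference vector
    (∀ v : V → ℝ, (∀ i, 0 < v i) →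
      (∀ x : V → ℝ, RankingLimits.IsDominantRightEigenvector A x →
        RankingLimits.RankingsConverge (RankingLimits.katzBroadcast A v) (𝓝[<] (1 / lam₁)) x ∧
        RankingLimits.RankingsConverge (RankingLimits.expBroadcast A v) atTop x) ∧
      (∀ y : V → ℝ, RankingLimits.IsDominantLeftEigenvector A y →
        RankingLimits.RankingsConverge (RankingLimits.katzReceive A v) (𝓝[<] (1 / lam₁)) y ∧
        RankingLimits.RankingsConverge (RankingLimits.expReceive A v) atTop y)) := by
  open RankingLimits in
  subst hA hlam₁
  have hA := hG.adjacency_isIrreducible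
  have hr := dominantEigenvalue_pos hA
  have hleft := fun y => isDominantRightEigenvector_transpose (y := y) hA
  have hrT := dominantEigenvalue_transpose hA
  obtain ⟨x₀, hx₀⟩ := exists_isDominantRightEigenvector hA
  obtain ⟨y₀, hy₀⟩ := exists_isDominantRightEigenvector hA.transpose
  have hy₀' := (hleft y₀).1 hy₀
  refine ⟨⟨hr, fun α hα hα' => ?_, ⟨x₀, hx₀⟩, ⟨y₀, hy₀'⟩⟩, ⟨?_, ?_, ?_, ?_⟩, fun v hv =>
    ⟨fun x hx => ⟨?_, ?_⟩, fun y hy => ⟨?_, ?_⟩⟩⟩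
  · have h := isUnit_one_sub_smul hA.nonneg hx₀.1 hx₀.2 hr hα hα'
    refine ⟨h, ?_⟩
    rw [← isUnit_transpose] at h
    simpa using h
  · rw [← adjacency_mulVec_one]
    exact katzBroadcast_rankingsConverge_zero _
  · rw [← adjacency_transpose_mulVec_one]
    exact katzBroadcast_rankingsConverge_zero _
  · rw [← adjacency_mulVec_one]
    exact expBroadcast_rankingsConverge_zero _
  · rw [← adjacency_transpose_mulVec_one]
    exact expBroadcast_rankingsConverge_zero _
  · exact katzBroadcast_rankingsConverge_inv hA hr hx.1 hx.2 hy₀'.1 hy₀'.2 hv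
  · exact expBroadcast_rankingsConverge_atTop hA hx.1 hx.2 hy₀'.1 hy₀'.2 hv
  · exact katzBroadcast_rankingsConverge_inv hA.transpose hr hy.1 (by rw [mulVec_transpose, hy.2])
      hx₀.1 (by rw [vecMul_transpose, hx₀.2]) hv
  · exact expBroadcast_rankingsConverge_atTop hA.transpose hy.1 (by rw [mulVec_transpose, hy.2])
      hx₀.1 (by rw [vecMul_transpose, hx₀.2]) hv
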